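/- **Energy inequality for a time-discrete Cahn–Hilliard–Navier–Stokes scheme with moving contact line.** *Setting.* Let $n=2$ and $q>2$, or $n=3$ and $q\ge 3$, and let $\Omega\subset\mathbb R^n$ be a bounded Lipschitz domain. Write $(\cdot,\cdot)$ and $(\cdot,\cdot)_{\partial\Omega}$ for the inner products of $L^2(\Omega)$ and $L^2(\partial\Omega)$, and $H_\sigma(\Omega)=\{v\in H^1_0(\Omega)^n : (\operatorname{div}v,p)=0\ \forall p\in L^2(\Omega),\ \int_\Omega p=0\}$, $Dv=\frac12(\nabla v+(\nabla v)^t)$, $a(z,v,w)=\frac12\int_\Omega((z\cdot\nabla)v)\cdot w-\frac12\int_\Omega((z\cdot\nabla)w)\cdot v$. *Data.* Let $\tau,\epsilon,b,\sigma_{lg},c_W>0$, $r\ge 0$, $\sigma=c_W\sigma_{lg}$, $\sigma_{sl},\sigma_{sg},\theta_{eq}\in\mathbb R$, $g\in\mathbb R^n$. Let $\rho\in C^2(\mathbb R)$ and $\eta\in C^1(\mathbb R)$ be bounded, strictly positive and globally Lipschitz, and let $\rho$ attain its minimum $\rho_{\min}$. Let $W\in C^2(\mathbb R)$ with $W''$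 locally Lipschitz, $W(\pm1)=0$ and $W>0$ elsewhere, and let $W=W_++W_-$ with $W_+$ convex, $W_-$ concave, both twice differentiable, $W_+'(0)=0$, such that each $f\in\{W,W_+,W_-\}$ satisfies $f(s)\le C(1+|s|^4)$, $|f'(s)|\le C(1+|s|^3)$, $|f''(s)|\le C(1+|s|^2)$ for some constant $C$. Let $\vartheta\in C^2(\mathbb R)$ with $\vartheta=-\frac12$ on $(-\infty,-1]$ and $\vartheta=\frac12$ on $[1,\infty)$. Let $M\in\mathbb N$, $T=M\tau$, $t_m=m\tau$, let $U$ be a normed space, $B:U\to L^2(0,T;L^2(\partial\Omega))$ linear, continuous and injective, and let $u\in U$ satisfy $-1\le\cos\theta_{eq}+Bu\le1$ almost everywhere. Put $B_mu=\frac1\tau\int_{t_{m-1}}^{t_m}(Bu)(t)\,dt\in L^2(\partial\Omega)$ and, for $m=1,\dots,M$, $$\gamma^m(s)=\frac{\sigma_{sl}+\sigma_{sg}}2+\sigma_{lg}(\cos\theta_{eq}+B_mu)\,\vartheta(s)\qquad\text{(a function of }s\in\mathbb R\text{ and of the point of }\partial\Omega),$$ and let $S_\gamma\in\mathbb R$ satisfy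 $S_\gamma\ge|(\gamma^m)''(s)|$ for all $s\in\mathbb R$, all $m$, and almost every point of $\partial\Omega$. *Scheme.* Let $v^0\in H_\sigma(\Omega)$, $\varphi^0\in H^1(\Omega)\cap L^\infty(\Omega)$, and let $v^m\in H_\sigma(\Omega)$, $\varphi^m\in H^1(\Omega)\cap L^\infty(\Omega)$, $\mu^m\in W^{1,q}(\Omega)$ $(m=1,\dots,M)$ be such that, for $m=1,\dots,M$ and all $w\in H_\sigma(\Omega)$, $\Psi,\Phi\in H^1(\Omega)$, with $\rho^m=\rho(\varphi^m)$, $\eta^m=\eta(\varphi^m)$, $J^m=-b\rho'(\varphi^m)\nabla\mu^m$, $B^m=(\varphi^m-\varphi^{m-1})/\tau$ and boundary values understood as traces, $$\tfrac1\tau\big(\tfrac{\rho^m+\rho^{m-1}}2v^m-\rho^{m-1}v^{m-1},w\big)+a(\rho^{m-1}v^{m-1}+J^m,v^m,w)+(2\eta^mDv^m,Dw)+(\varphi^{m-1}\nabla\mu^m,w)-(g\rho^m,w)=0,$$ $$\tfrac1\tau(\varphi^m-\varphi^{m-1},\Psi)-(\varphi^{m-1}v^{m-1},\nabla\Psi)+\tfrac\tau{\rho_{\min}}(|\varphi^{m-1}|^2\nabla\mu^m,\nabla\Psi)+b(\nabla\mu^m,\nabla\Psi)=0,$$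 $$\sigma\epsilon(\nabla\varphi^m,\nabla\Phi)+\tfrac\sigma\epsilon(W_+'(\varphi^m)+W_-'(\varphi^{m-1}),\Phi)-(\mu^m,\Phi)+r(B^m,\Phi)_{\partial\Omega}+\big(\tfrac{S_\gamma}2(\varphi^m-\varphi^{m-1})+(\gamma^m)'(\varphi^{m-1}),\Phi\big)_{\partial\Omega}=0.$$ *Claim.* Put $$E^m=\frac12\int_\Omega\rho^m|v^m|^2+\sigma\int_\Omega\Big(\frac\epsilon2|\nabla\varphi^m|^2+\frac1\epsilon W(\varphi^m)\Big),\qquad D^m=\int_\Omega2\eta^m|Dv^m|^2+b\int_\Omega|\nabla\mu^m|^2+r\int_{\partial\Omega}|B^m|^2 .$$ Then for every $m\in\{1,\dots,M\}$: 1. (one step) $\displaystyle E^m+\int_{\partial\Omega}\gamma^m(\varphi^m)+\tau D^m\le E^{m-1}+\int_{\partial\Omega}\gamma^m(\varphi^{m-1})+\tau\int_\Omega\rho^mg\cdot v^m .$ 2. (cumulative) $\displaystyle E^m+\int_{\partial\Omega}\gamma^m(\varphi^m)+\tau\sum_{k=1}^mD^k\le E^0+\int_{\partial\Omega}\gamma^1(\varphi^0)+\tau\sum_{k=1}^m\int_\Omega\rho^kg\cdot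 v^k+\sum_{k=1}^{m-1}\int_{\partial\Omega}\big(\gamma^{k+1}(\varphi^k)-\gamma^k(\varphi^k)\big).$ 3. (cumulative, fixed contact line energy) If $B_ku=B_1u$ for $k=1,\dots,m$, so that $\gamma^1=\dots=\gamma^m=:\gamma$, then $$E^m+\int_{\partial\Omega}\gamma(\varphi^m)+\tau\sum_{k=1}^mD^k\le E^0+\int_{\partial\Omega}\gamma(\varphi^0)+\tau\sum_{k=1}^m\int_\Omega\rho^kg\cdot v^k .$$ -/

import Mathlib

open MeasureTheory Filter Topology
open scoped ENNReal NNReal ContDiff InnerProductSpace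

noncomputable section

/-- The Euclidean space `ℝⁿ`. -/
abbrev Eu (n : ℕ) : Type := EuclideanSpace ℝ (Fin n)

/-! ### Domains, Sobolev functions, traces -/

/-- Bounded Lipschitz domain: open, bounded, connected, nonempty, and near each boundary point
`Ω` is the part lying strictly above the graph (in some direction `e`) of a Lipschitz function;
`f` depends only on the components orthogonal to `e`. -/
structure IsLipschitzDomain {n : ℕ} (Ω : Set (Eu n)) : Prop where
  isOpen : IsOpen Ω
  isBounded : Bornology.IsBounded Ω
  isConnected : IsConnected Ω
  graph : ∀ x ∈ frontier Ω, ∃ (e : Eu n) (f : Eu n → ℝ) (K : ℝ≥0) (V : Set (Eu n)),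
    ‖e‖ = 1 ∧ LipschitzWith K f ∧ (∀ y : Eu n, ∀ t : ℝ, f (y + t • e) = f y) ∧
    IsOpen V ∧ x ∈ V ∧ ∀ y ∈ V, (y ∈ Ω ↔ f y < ⟪e, y⟫_ℝ)

/-- The surface measure on `∂Ω`: normalised `(n-1)`-dimensional Hausdorff measure. -/
def surf {n : ℕ} (Ω : Set (Eu n)) : Measure (Eu n) :=
  (Measure.euclideanHausdorffMeasure (n - 1)).restrict (frontier Ω)

/-- The test functions `C_c^∞(Ω)`. -/
structure IsTestFunction {n : ℕ} (Ω : Set (Eu n)) (ψ : Eu n → ℝ) : Prop where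
  smooth : ContDiff ℝ ∞ ψ
  compact : HasCompactSupport ψ
  support : tsupport ψ ⊆ Ω

/-- `G` is the weak gradient of `f` in `Ω`. -/
def HasWeakGradient {n : ℕ} (Ω : Set (Eu n)) (f : Eu n → ℝ) (G : Eu n → Eu n) : Prop :=
  ∀ ψ : Eu n → ℝ, IsTestFunction Ω ψ → ∀ i : Fin n,
    ∫ x in Ω, f x * (gradient ψ x) i = - ∫ x in Ω, G x i * ψ x

/-- The elements of `W^{1,p}(Ω)`, as representatives together with their weak gradients. -/
structure W1 {n : ℕ} (Ω : Set (Eu n)) (p : ℝ≥0∞) where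
  toFun : Eu n → ℝ
  grad : Eu n → Eu n
  memLp_toFun : MemLp toFun p (volume.restrict Ω)
  memLp_grad : MemLp grad p (volume.restrict Ω)
  weak : HasWeakGradient Ω toFun grad

/-- `H¹(Ω)`. -/
abbrev H1 {n : ℕ} (Ω : Set (Eu n)) : Type := W1 Ω 2

/-- The sequence `ψ` of smooth functions converges to `f` in `H¹(Ω)`. -/
def TendstoH1 {n : ℕ} {Ω : Set (Eu n)} (ψ : ℕ → Eu n → ℝ) (f : H1 Ω) : Prop :=
  Tendsto (fun k => eLpNorm (fun x => ψ k x - f.toFun x) 2 (volume.restrict Ω)) atTop (𝓝 0) ∧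
  Tendsto (fun k => eLpNorm (fun x => gradient (ψ k) x - f.grad x) 2 (volume.restrict Ω))
    atTop (𝓝 0)

/-- `g ∈ L²(∂Ω)` is the boundary trace of `f ∈ H¹(Ω)`: the trace operator is the continuous
extension of the restriction `ψ ↦ ψ|_∂Ω` of functions smooth up to the boundary. -/
def IsTrace {n : ℕ} {Ω : Set (Eu n)} (f : H1 Ω) (g : Eu n → ℝ) : Prop :=
  MemLp g 2 (surf Ω) ∧
  ∃ ψ : ℕ → Eu n → ℝ, (∀ k, ContDiff ℝ ∞ (ψ k)) ∧ TendstoH1 ψ f ∧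
    Tendsto (fun k => eLpNorm (fun x => ψ k x - g x) 2 (surf Ω)) atTop (𝓝 0)

/-- `f ∈ H¹₀(Ω)`, the closure of `C_c^∞(Ω)` in `H¹(Ω)`. -/
def IsH10 {n : ℕ} {Ω : Set (Eu n)} (f : H1 Ω) : Prop :=
  ∃ ψ : ℕ → Eu n → ℝ, (∀ k, IsTestFunction Ω (ψ k)) ∧ TendstoH1 ψ f

/-- The elements of `H_σ(Ω)`: vector fields in `H¹₀(Ω)ⁿ` whose divergence is `L²`-orthogonal to
all `q ∈ L²(Ω)` with zero mean. -/
structure HSol {n : ℕ} (Ω : Set (Eu n)) where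
  comp : Fin n → H1 Ω
  zero_boundary : ∀ i, IsH10 (comp i)
  solenoidal : ∀ q : Eu n → ℝ, MemLp q 2 (volume.restrict Ω) → ∫ x in Ω, q x = 0 →
    ∫ x in Ω, (∑ i, (comp i).grad x i) * q x = 0

/-- The vector field itself. -/
def HSol.vec {n : ℕ} {Ω : Set (Eu n)} (v : HSol Ω) (x : Eu n) : Eu n :=
  WithLp.toLp 2 fun i => (v.comp i).toFun x

/-- The symmetric gradient `Dv = (∇v + (∇v)ᵗ) / 2`. -/
def HSol.symGrad {n : ℕ} {Ω : Set (Eu n)} (v : HSol Ω) (x : Eu n) :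
    Matrix (Fin n) (Fin n) ℝ :=
  fun i j => ((v.comp i).grad x j + (v.comp j).grad x i) / 2

/-- The Frobenius product `A : B`. -/
def ddot {n : ℕ} (A B : Matrix (Fin n) (Fin n) ℝ) : ℝ := ∑ i, ∑ j, A i j * B i j

/-- The convective derivative `(a · ∇) v`. -/
def HSol.convect {n : ℕ} {Ω : Set (Eu n)} (a : Eu n → Eu n) (v : HSol Ω) (x : Eu n) : Eu n :=
  WithLp.toLp 2 fun i => ⟪a x, (v.comp i).grad x⟫_ℝ

/-- The trilinear form
`a(u,v,w) = ½ ∫ ((u·∇)v)·w - ½ ∫ ((u·∇)w)·v`. -/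
def triForm {n : ℕ} {Ω : Set (Eu n)} (a : Eu n → Eu n) (v w : HSol Ω) : ℝ :=
  (1 / 2) * (∫ x in Ω, ⟪v.convect a x, w.vec x⟫_ℝ)
    - (1 / 2) * (∫ x in Ω, ⟪w.convect a x, v.vec x⟫_ℝ)

/-! ### Data of the model -/

/-- `f ≤ C(1+|s|⁴)`, `|f'| ≤ C(1+|s|³)`, `|f''| ≤ C(1+|s|²)`. -/
def QuarticGrowth (f : ℝ → ℝ) : Prop :=
  ∃ C : ℝ, 0 < C ∧ ∀ s : ℝ, f s ≤ C * (1 + |s| ^ 4) ∧ |deriv f s| ≤ C * (1 + |s| ^ 3) ∧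
    |deriv (deriv f) s| ≤ C * (1 + |s| ^ 2)

/-- The constants and coefficient functions of the model and of the time discretisation. -/
structure ModelData (n : ℕ) where
  /-- time step size -/
  τ : ℝ
  /-- interface width -/
  ε : ℝ
  /-- mobility -/
  b : ℝ
  /-- boundary relaxation parameter -/
  r : ℝ
  /-- liquid-gas, solid-liquid and solid-gas surface tensions -/
  σlg : ℝ
  σsl : ℝ
  σsg : ℝ
  /-- scaling constant of the surface tension -/
  cW : ℝ
  /-- equilibrium contact angle -/
  θeq : ℝ
  /-- stabilisation parameter -/
  Sγ : ℝ
  /-- minimum of the density -/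
  ρmin : ℝ
  /-- gravitational acceleration -/
  g : Eu n
  /-- density and viscosity as functions of the phase field -/
  ρ : ℝ → ℝ
  η : ℝ → ℝ
  /-- double well potential and its convex and concave parts -/
  W : ℝ → ℝ
  Wconv : ℝ → ℝ
  Wconc : ℝ → ℝ
  /-- interpolation function of the contact line energy -/
  ϑ : ℝ → ℝ

/-- The standing assumptions on the data. -/
structure ModelData.Admissible {n : ℕ} (P : ModelData n) : Prop where
  τ_pos : 0 < P.τ
  ε_pos : 0 < P.ε
  b_pos : 0 < P.b
  r_nonneg : 0 ≤ P.r
  σlg_pos : 0 < P.σlg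
  cW_pos : 0 < P.cW
  ρ_smooth : ContDiff ℝ 2 P.ρ
  ρ_pos : ∀ s, 0 < P.ρ s
  ρ_bdd : ∃ C, ∀ s, P.ρ s ≤ C
  ρ_lip : ∃ K, LipschitzWith K P.ρ
  ρmin_isLeast : IsLeast (Set.range P.ρ) P.ρmin
  η_smooth : ContDiff ℝ 1 P.η
  η_pos : ∀ s, 0 < P.η s
  η_bdd : ∃ C, ∀ s, P.η s ≤ C
  η_lip : ∃ K, LipschitzWith K P.η
  W_smooth : ContDiff ℝ 2 P.W
  W_lip : LocallyLipschitz (deriv (deriv P.W))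
  W_one : P.W 1 = 0
  W_neg_one : P.W (-1) = 0
  W_pos : ∀ s, s ≠ 1 → s ≠ -1 → 0 < P.W s
  W_growth : QuarticGrowth P.W
  W_split : ∀ s, P.W s = P.Wconv s + P.Wconc s
  Wconv_convex : ConvexOn ℝ Set.univ P.Wconv
  Wconc_concave : ConcaveOn ℝ Set.univ P.Wconc
  Wconv_diff : Differentiable ℝ P.Wconv ∧ Differentiable ℝ (deriv P.Wconv)
  Wconc_diff : Differentiable ℝ P.Wconc ∧ Differentiable ℝ (deriv P.Wconc)
  Wconv_zero : deriv P.Wconv 0 = 0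
  Wconv_growth : QuarticGrowth P.Wconv
  Wconc_growth : QuarticGrowth P.Wconc
  ϑ_smooth : ContDiff ℝ 2 P.ϑ
  ϑ_left : ∀ s, s ≤ -1 → P.ϑ s = -(1 / 2)
  ϑ_right : ∀ s, 1 ≤ s → P.ϑ s = 1 / 2

/-- `σ = c_W σ_lg`. -/
def ModelData.σ {n : ℕ} (P : ModelData n) : ℝ := P.cW * P.σlg

/-- The contact line energy density
`γ(s) = (σ_sl + σ_sg)/2 + σ_lg c ϑ(s)`, where `c` is the cosine of the contact angle. -/
def ModelData.γ {n : ℕ} (P : ModelData n) (c : ℝ) (s : ℝ) : ℝ :=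
  (P.σsl + P.σsg) / 2 + P.σlg * c * P.ϑ s

/-! ### Controls -/

/-- `L²(0,T; L²(∂Ω))`. -/
abbrev BoundaryL2 {n : ℕ} (Ω : Set (Eu n)) (T : ℝ) : Type :=
  Lp (Lp ℝ 2 (surf Ω)) 2 (volume.restrict (Set.Ioo 0 T))

/-- The set `U_ad⁰` of controls with `-1 ≤ cos θ_eq + Bu ≤ 1`. -/
def admissibleControls {n : ℕ} {Ω : Set (Eu n)} {T : ℝ} {U : Type*} [NormedAddCommGroup U]
    [NormedSpace ℝ U] (P : ModelData n) (B : U →L[ℝ] BoundaryL2 Ω T) : Set U :=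
  {u | ∀ᵐ t ∂(volume.restrict (Set.Ioo 0 T)), ∀ᵐ x ∂(surf Ω),
    -1 ≤ Real.cos P.θeq + ((B u : ℝ → Lp ℝ 2 (surf Ω)) t : Eu n → ℝ) x ∧
    Real.cos P.θeq + ((B u : ℝ → Lp ℝ 2 (surf Ω)) t : Eu n → ℝ) x ≤ 1}

/-- The time average `B_m u = (1/τ) ∫_{t_{m-1}}^{t_m} (Bu)(t) dt ∈ L²(∂Ω)` with `t_m = m τ`. -/
def controlMean {n : ℕ} {Ω : Set (Eu n)} {T : ℝ} (τ : ℝ) (f : BoundaryL2 Ω T) (m : ℕ) :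
    Lp ℝ 2 (surf Ω) :=
  (1 / τ) • ∫ t in (((m : ℝ) - 1) * τ)..((m : ℝ) * τ), (f : ℝ → Lp ℝ 2 (surf Ω)) t

/-- `cos θ_eq + B_m u` as a function on `∂Ω`. -/
def angleCoeff {n : ℕ} {Ω : Set (Eu n)} {T : ℝ} (P : ModelData n) (f : BoundaryL2 Ω T)
    (m : ℕ) (x : Eu n) : ℝ :=
  Real.cos P.θeq + (controlMean P.τ f m : Eu n → ℝ) x

/-! ### The time discrete scheme -/

/-- The momentum equation, with old values `v₀, φ₀` and new values `v, φ, μ`. -/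
def MomentumEq {n : ℕ} {Ω : Set (Eu n)} {q : ℝ≥0∞} (P : ModelData n)
    (v₀ v : HSol Ω) (φ₀ φ : H1 Ω) (μ : W1 Ω q) : Prop :=
  ∀ w : HSol Ω,
    (1 / P.τ) * (∫ x in Ω, ⟪((P.ρ (φ.toFun x) + P.ρ (φ₀.toFun x)) / 2) • v.vec x
        - P.ρ (φ₀.toFun x) • v₀.vec x, w.vec x⟫_ℝ)
      + triForm (fun x => P.ρ (φ₀.toFun x) • v₀.vec x
          + (-(P.b * deriv P.ρ (φ.toFun x))) • μ.grad x) v w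
      + (∫ x in Ω, 2 * P.η (φ.toFun x) * ddot (v.symGrad x) (w.symGrad x))
      + (∫ x in Ω, ⟪φ₀.toFun x • μ.grad x, w.vec x⟫_ℝ)
      - (∫ x in Ω, ⟪P.ρ (φ.toFun x) • P.g, w.vec x⟫_ℝ) = 0

/-- The phase field equation. -/
def PhaseEq {n : ℕ} {Ω : Set (Eu n)} {q : ℝ≥0∞} (P : ModelData n)
    (v₀ : HSol Ω) (φ₀ φ : H1 Ω) (μ : W1 Ω q) : Prop :=
  ∀ Ψ : H1 Ω,
    (1 / P.τ) * (∫ x in Ω, (φ.toFun x - φ₀.toFun x) * Ψ.toFun x)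
      - (∫ x in Ω, ⟪φ₀.toFun x • v₀.vec x, Ψ.grad x⟫_ℝ)
      + (P.τ / P.ρmin) * (∫ x in Ω, ⟪|φ₀.toFun x| ^ 2 • μ.grad x, Ψ.grad x⟫_ℝ)
      + P.b * (∫ x in Ω, ⟪μ.grad x, Ψ.grad x⟫_ℝ) = 0

/-- The equation for the chemical potential; `φΓ₀`, `φΓ`, `ΦΓ` are boundary traces and `c` is the
cosine of the prescribed contact angle. -/
def PotentialEq {n : ℕ} {Ω : Set (Eu n)} {q : ℝ≥0∞} (P : ModelData n) (c : Eu n → ℝ)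
    (φ₀ φ : H1 Ω) (φΓ₀ φΓ : Eu n → ℝ) (μ : W1 Ω q) : Prop :=
  ∀ (Φ : H1 Ω) (ΦΓ : Eu n → ℝ), IsTrace Φ ΦΓ →
    P.σ * P.ε * (∫ x in Ω, ⟪φ.grad x, Φ.grad x⟫_ℝ)
      + (P.σ / P.ε) *
        (∫ x in Ω, (deriv P.Wconv (φ.toFun x) + deriv P.Wconc (φ₀.toFun x)) * Φ.toFun x)
      - (∫ x in Ω, μ.toFun x * Φ.toFun x)
      + P.r * (∫ x, (φΓ x - φΓ₀ x) / P.τ * ΦΓ x ∂(surf Ω))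
      + (∫ x, (P.Sγ / 2 * (φΓ x - φΓ₀ x) + deriv (P.γ (c x)) (φΓ₀ x)) * ΦΓ x ∂(surf Ω)) = 0

/-- `(v^m, φ^m, μ^m)`, `1 ≤ m ≤ M`, solves the scheme with initial data `v⁰, φ⁰` and contact angle
coefficients `c m`; `φΓ m` is the boundary trace of `φ^m`. -/
structure IsSolution {n : ℕ} {Ω : Set (Eu n)} {q : ℝ≥0∞} (P : ModelData n) (M : ℕ)
    (c : ℕ → Eu n → ℝ) (v : ℕ → HSol Ω) (φ : ℕ → H1 Ω) (φΓ : ℕ → Eu n → ℝ)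
    (μ : ℕ → W1 Ω q) : Prop where
  bounded : ∀ m ≤ M, MemLp (φ m).toFun ∞ (volume.restrict Ω)
  trace : ∀ m ≤ M, IsTrace (φ m) (φΓ m)
  momentum : ∀ m, 1 ≤ m → m ≤ M → MomentumEq P (v (m - 1)) (v m) (φ (m - 1)) (φ m) (μ m)
  phase : ∀ m, 1 ≤ m → m ≤ M → PhaseEq P (v (m - 1)) (φ (m - 1)) (φ m) (μ m)
  potential : ∀ m, 1 ≤ m → m ≤ M →
    PotentialEq P (c m) (φ (m - 1)) (φ m) (φΓ (m - 1)) (φΓ m) (μ m)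

/-! ### Energies -/

/-- Kinetic plus Ginzburg-Landau energy. -/
def bulkEnergy {n : ℕ} {Ω : Set (Eu n)} (P : ModelData n) (v : HSol Ω) (φ : H1 Ω) : ℝ :=
  (1 / 2) * (∫ x in Ω, P.ρ (φ.toFun x) * ‖v.vec x‖ ^ 2)
    + P.σ * (∫ x in Ω, (P.ε / 2 * ‖φ.grad x‖ ^ 2 + 1 / P.ε * P.W (φ.toFun x)))

/-- Contact line energy `∫_∂Ω γ(φ)` for the angle coefficient `c`. -/
def lineEnergy {n : ℕ} (Ω : Set (Eu n)) (P : ModelData n) (c φΓ : Eu n → ℝ) : ℝ :=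
  ∫ x, P.γ (c x) (φΓ x) ∂(surf Ω)

/-- Dissipation `∫ 2η|Dv|² + b ∫ |∇μ|² + r ∫_∂Ω |(φ - φ₀)/τ|²`. -/
def dissipation {n : ℕ} {Ω : Set (Eu n)} {q : ℝ≥0∞} (P : ModelData n) (v : HSol Ω) (φ : H1 Ω)
    (φΓ₀ φΓ : Eu n → ℝ) (μ : W1 Ω q) : ℝ :=
  (∫ x in Ω, 2 * P.η (φ.toFun x) * ddot (v.symGrad x) (v.symGrad x))
    + P.b * (∫ x in Ω, ‖μ.grad x‖ ^ 2)
    + P.r * (∫ x, |(φΓ x - φΓ₀ x) / P.τ| ^ 2 ∂(surf Ω))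

/-- Power of gravity `∫ ρ g · v`. -/
def gravityPower {n : ℕ} {Ω : Set (Eu n)} (P : ModelData n) (v : HSol Ω) (φ : H1 Ω) : ℝ :=
  ∫ x in Ω, P.ρ (φ.toFun x) * ⟪P.g, v.vec x⟫_ℝ

end

/-!
The energy inequality is the discrete counterpart of the formal energy law: the momentum equation is
tested with the new velocity `v`, the phase field equation with the chemical potential `μ`, and the
potential equation with the increment `φ - φ₀`. The trilinear form vanishes on the diagonal, and the
terms `∫ μ (φ - φ₀)` cancel. What remains splits into three parts, each of which dominates the
corresponding difference of energies.

* Kinetic energy (`integral_kinetic_le`). The capillary force `φ₀ ∇μ` acts on the new velocity, but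
  the phase field is transported by the old one. The mismatch `τ φ₀ ∇μ · (v - v₀)` is absorbed by
  completing the square with `ρ₀ |v - v₀|² / 2` and half of the stabilising term
  `τ² φ₀² |∇μ|² / ρ_min`.
* Ginzburg-Landau energy (`integral_ginzburgLandau_le`). The convex part of the double well is
  treated implicitly and the concave part explicitly, so both tangent line inequalities have the
  favourable sign.
* Contact line energy (`lineEnergy_le`). Taylor's inequality with the bound `S_γ` on the second
  derivative of `γ`.

The integrals involved are finite because the phase fields are bounded, the velocities and all
gradients are square integrable (`q ≥ 2`), and the surface measure of a bounded Lipschitz domain is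
finite (`IsLipschitzDomain.isFiniteMeasure_surf`): the boundary is covered by finitely many Lipschitz
images of bounded subsets of hyperplanes. Summation over the time steps telescopes up to the changes
of the contact line energy at a fixed phase field (`sum_energy_steps`).
-/

/-! ### Finiteness of the surface measure -/

/-- Near a boundary point, `∂Ω` lies on the graph of a Lipschitz function over the hyperplane
orthogonal to `e`, hence in a Lipschitz image of that hyperplane. -/
theorem IsLipschitzDomain.exists_nhds_hausdorffMeasure_lt_top {n : ℕ} {Ω : Set (Eu n)}
    (hΩ : IsLipschitzDomain Ω) {x : Eu n} (hx : x ∈ frontier Ω) :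
    ∃ V : Set (Eu n), IsOpen V ∧ x ∈ V ∧
      Measure.euclideanHausdorffMeasure (n - 1) (frontier Ω ∩ V) < ⊤ := by
  obtain ⟨e, f, K, V, he, hf, hfe, hV, hxV, hgraph⟩ := hΩ.graph x hx
  refine ⟨V, hV, hxV, ?_⟩
  have hee : ⟪e, e⟫_ℝ = 1 := by rw [real_inner_self_eq_norm_sq, he]; norm_num
  have hn : n ≠ 0 := by
    rintro rfl
    rw [Subsingleton.elim e 0, norm_zero] at he
    exact zero_ne_one he
  have hdim : Module.finrank ℝ (Eu n) = (n - 1) + 1 := by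
    rw [finrank_euclideanSpace_fin]; omega
  have : Fact (Module.finrank ℝ (Eu n) = (n - 1) + 1) := ⟨hdim⟩
  have hH : Module.finrank ℝ ((ℝ ∙ e)ᗮ : Submodule ℝ (Eu n)) = n - 1 :=
    Submodule.finrank_orthogonal_span_singleton (by rintro rfl; simp at he)
  obtain ⟨R, hR⟩ := hΩ.isBounded.closure.exists_norm_le
  let Γ : ((ℝ ∙ e)ᗮ : Submodule ℝ (Eu n)) → Eu n := fun z => (z : Eu n) + f z • e
  have hΓ : LipschitzWith (1 + K) Γ := by
    refine LipschitzWith.of_dist_le_mul fun z z' => ?_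
    have h1 := hf.dist_le_mul (z : Eu n) z'
    rw [Real.dist_eq] at h1
    have h2 : Γ z - Γ z' = ((z : Eu n) - z') + (f z - f z') • e := by
      simp only [Γ, sub_smul]; abel
    rw [dist_eq_norm, h2, NNReal.coe_add, NNReal.coe_one, add_mul, one_mul]
    refine (norm_add_le _ _).trans (add_le_add (le_of_eq ?_) ?_)
    · rw [← dist_eq_norm]; rfl
    · rw [norm_smul, he, mul_one]; exact h1
  have hsub : frontier Ω ∩ V ⊆ Γ '' Metric.closedBall 0 R := by
    rintro y ⟨hy, hyV⟩
    have hyΩ : y ∉ Ω := (hΩ.isOpen.frontier_eq ▸ hy).2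
    -- `y` is not in the open set `Ω`, hence not above the graph; strictly below the graph it would
    -- have a neighbourhood disjoint from `Ω`
    have hle : ⟪e, y⟫_ℝ ≤ f y := by
      by_contra h
      exact hyΩ ((hgraph y hyV).2 (not_le.1 h))
    have hge : f y ≤ ⟪e, y⟫_ℝ := by
      by_contra h
      have hopen : IsOpen (V ∩ {z | ⟪e, z⟫_ℝ < f z}) :=
        hV.inter (isOpen_lt (continuous_const.inner continuous_id) hf.continuous)
      obtain ⟨z, ⟨hzV, hz⟩, hzΩ⟩ :=
        mem_closure_iff.1 (frontier_subset_closure hy) _ hopen ⟨hyV, not_le.1 h⟩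
      exact lt_asymm hz ((hgraph z hzV).1 hzΩ)
    have hmem : y - ⟪e, y⟫_ℝ • e ∈ (ℝ ∙ e)ᗮ := by
      rw [Submodule.mem_orthogonal_singleton_iff_inner_right, inner_sub_right, inner_smul_right,
        hee, mul_one, sub_self]
    refine ⟨⟨_, hmem⟩, ?_, ?_⟩
    · rw [mem_closedBall_zero_iff, Submodule.coe_norm]
      refine le_trans ?_ (hR y (frontier_subset_closure hy))
      refine (sq_le_sq₀ (norm_nonneg _) (norm_nonneg _)).1 ?_
      rw [norm_sub_sq_real, inner_smul_right, real_inner_comm, norm_smul, he, mul_one,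
        Real.norm_eq_abs, sq_abs]
      nlinarith [sq_nonneg ⟪y, e⟫_ℝ, real_inner_comm e y]
    · have h := hfe y (-⟪e, y⟫_ℝ)
      rw [neg_smul, ← sub_eq_add_neg] at h
      simp only [Γ, h, le_antisymm hge hle, sub_add_cancel]
  have hball : Measure.hausdorffMeasure ((n - 1 : ℕ) : ℝ)
      (Metric.closedBall (0 : ((ℝ ∙ e)ᗮ : Submodule ℝ (Eu n))) R) < ⊤ := by
    have := isAddHaarMeasure_hausdorffMeasure (E := ((ℝ ∙ e)ᗮ : Submodule ℝ (Eu n)))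
    rw [hH] at this
    exact (isCompact_closedBall _ _).measure_lt_top
  rw [Measure.euclideanHausdorffMeasure_def, Measure.smul_apply]
  refine ENNReal.mul_lt_top ENNReal.coe_lt_top ?_
  refine (measure_mono hsub).trans_lt ?_
  refine (hΓ.hausdorffMeasure_image_le (Nat.cast_nonneg _) _).trans_lt ?_
  exact ENNReal.mul_lt_top (ENNReal.rpow_lt_top_of_nonneg (Nat.cast_nonneg _) ENNReal.coe_ne_top)
    hball

theorem IsLipschitzDomain.isFiniteMeasure_surf {n : ℕ} {Ω : Set (Eu n)}
    (hΩ : IsLipschitzDomain Ω) : IsFiniteMeasure (surf Ω) := by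
  have hcomp : IsCompact (frontier Ω) :=
    hΩ.isBounded.isCompact_closure.of_isClosed_subset isClosed_frontier frontier_subset_closure
  refine ⟨?_⟩
  rw [surf, Measure.restrict_apply_univ]
  refine hcomp.measure_lt_top_of_nhdsWithin fun x hx => ?_
  obtain ⟨V, hV, hxV, hfin⟩ := hΩ.exists_nhds_hausdorffMeasure_lt_top hx
  exact ⟨_, inter_mem self_mem_nhdsWithin (mem_nhdsWithin_of_mem_nhds (hV.mem_nhds hxV)), hfin⟩

theorem IsLipschitzDomain.isFiniteMeasure_restrict {n : ℕ} {Ω : Set (Eu n)}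
    (hΩ : IsLipschitzDomain Ω) : IsFiniteMeasure (volume.restrict Ω) :=
  MeasureTheory.isFiniteMeasure_restrict.2 hΩ.isBounded.measure_lt_top.ne

/-! ### Tangent line inequalities -/

theorem ConvexOn.deriv_mul_sub_le {f : ℝ → ℝ} (hf : ConvexOn ℝ Set.univ f)
    (hd : Differentiable ℝ f) (x y : ℝ) : deriv f x * (y - x) ≤ f y - f x := by
  rcases lt_trichotomy x y with h | rfl | h
  · have := hf.deriv_le_slope (Set.mem_univ x) (Set.mem_univ y) h (hd x)
    rw [slope_def_field, le_div_iff₀ (sub_pos.2 h)] at this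
    exact this
  · simp
  · have := hf.slope_le_deriv (Set.mem_univ y) (Set.mem_univ x) h (hd x)
    rw [slope_def_field, div_le_iff₀ (sub_pos.2 h)] at this
    linarith

theorem ConcaveOn.sub_le_deriv_mul_sub {f : ℝ → ℝ} (hf : ConcaveOn ℝ Set.univ f)
    (hd : Differentiable ℝ f) (x y : ℝ) : f y - f x ≤ deriv f x * (y - x) := by
  have := hf.neg.deriv_mul_sub_le hd.neg x y
  rw [deriv.neg] at this
  simp only [Pi.neg_apply] at this
  linarith

/-- Taylor's inequality to second order: `s ↦ S s² / 2 - f s` is convex. -/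
theorem sub_le_of_deriv_deriv_le {f : ℝ → ℝ} {S : ℝ} (hf : ContDiff ℝ 2 f)
    (hS : ∀ s, deriv (deriv f) s ≤ S) (x y : ℝ) :
    f y - f x ≤ (S / 2 * (y - x) + deriv f x) * (y - x) := by
  have hd : Differentiable ℝ f := hf.differentiable (by norm_num)
  have hd' : Differentiable ℝ (deriv f) := by
    have : ContDiff ℝ 1 (deriv f) := ((contDiff_succ_iff_deriv (n := 1)).1 hf).2.2
    exact this.differentiable (by norm_num)
  have h1 : ∀ s, HasDerivAt (fun s => S / 2 * s ^ 2 - f s) (S * s - deriv f s) s := fun s => by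
    have := ((hasDerivAt_pow 2 s).const_mul (S / 2)).sub (hd s).hasDerivAt
    refine this.congr_deriv ?_
    norm_num
    ring
  have h1' : deriv (fun s => S / 2 * s ^ 2 - f s) = fun s => S * s - deriv f s :=
    funext fun s => (h1 s).deriv
  have h2 : ∀ s, HasDerivAt (fun s => S * s - deriv f s) (S - deriv (deriv f) s) s := fun s => by
    refine (((hasDerivAt_id s).const_mul S).sub (hd' s).hasDerivAt).congr_deriv ?_
    rw [mul_one]
  have hconv : ConvexOn ℝ Set.univ (fun s => S / 2 * s ^ 2 - f s) := by
    refine convexOn_univ_of_deriv2_nonneg (fun s => (h1 s).differentiableAt) ?_ fun s => ?_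
    · rw [h1']; exact fun s => (h2 s).differentiableAt
    · rw [Function.iterate_succ_apply, Function.iterate_one, h1', (h2 s).deriv]
      linarith [hS s]
  have := hconv.deriv_mul_sub_le (fun s => (h1 s).differentiableAt) x y
  rw [(h1 x).deriv] at this
  nlinarith [this]

/-! ### Sobolev functions and traces -/

theorem continuous_gradient_of_contDiff {n : ℕ} {ψ : Eu n → ℝ} (hψ : ContDiff ℝ ∞ ψ) :
    Continuous (gradient ψ) :=
  (InnerProductSpace.toDual ℝ (Eu n)).symm.continuous.comp (hψ.continuous_fderiv (by simp))

theorem IsTestFunction.memLp_gradient {n : ℕ} {Ω : Set (Eu n)} {ψ : Eu n → ℝ}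
    (hψ : IsTestFunction Ω ψ) (i : Fin n) (p : ℝ≥0∞) (ν : Measure (Eu n))
    [IsFiniteMeasureOnCompacts ν] : MemLp (fun x => (gradient ψ x) i) p ν := by
  have hcont := continuous_gradient_of_contDiff hψ.smooth
  have hsupp : HasCompactSupport (gradient ψ) :=
    (hψ.compact.fderiv ℝ).comp_left (g := (InnerProductSpace.toDual ℝ (Eu n)).symm) (map_zero _)
  have hcont' : Continuous fun x => (gradient ψ x) i := by fun_prop
  exact hcont'.memLp_of_hasCompactSupport (hsupp.comp_left (g := fun z : Eu n => z i) rfl)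

theorem gradient_sub_of_contDiff {n : ℕ} {ψ χ : Eu n → ℝ} (hψ : ContDiff ℝ ∞ ψ)
    (hχ : ContDiff ℝ ∞ χ) (x : Eu n) :
    gradient (fun y => ψ y - χ y) x = gradient ψ x - gradient χ x := by
  rw [gradient, gradient, gradient, ← map_sub, fderiv_fun_sub]
  · exact (hψ.differentiable (by simp)) x
  · exact (hχ.differentiable (by simp)) x

/-- The difference of two elements of `H¹(Ω)`. -/
def W1.sub {n : ℕ} {Ω : Set (Eu n)} (f g : H1 Ω) : H1 Ω where
  toFun x := f.toFun x - g.toFun x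
  grad x := f.grad x - g.grad x
  memLp_toFun := f.memLp_toFun.sub g.memLp_toFun
  memLp_grad := f.memLp_grad.sub g.memLp_grad
  weak ψ hψ i := by
    have hg := hψ.memLp_gradient i 2 (volume.restrict Ω)
    have hψ2 : MemLp ψ 2 (volume.restrict Ω) :=
      hψ.smooth.continuous.memLp_of_hasCompactSupport hψ.compact
    have h1 : Integrable (fun x => f.toFun x * gradient ψ x i) (volume.restrict Ω) :=
      f.memLp_toFun.integrable_mul hg
    have h2 : Integrable (fun x => g.toFun x * gradient ψ x i) (volume.restrict Ω) :=
      g.memLp_toFun.integrable_mul hg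
    have h3 : Integrable (fun x => f.grad x i * ψ x) (volume.restrict Ω) :=
      (f.memLp_grad.eval_piLp i).integrable_mul hψ2
    have h4 : Integrable (fun x => g.grad x i * ψ x) (volume.restrict Ω) :=
      (g.memLp_grad.eval_piLp i).integrable_mul hψ2
    simp only [sub_mul, PiLp.sub_apply]
    rw [integral_sub h1 h2, integral_sub h3 h4,
      f.weak ψ hψ i, g.weak ψ hψ i]
    ring

/-- On a set of finite measure, `W^{1,q} ⊆ H¹` for `q ≥ 2`. -/
def W1.toH1 {n : ℕ} {Ω : Set (Eu n)} {q : ℝ≥0∞} [IsFiniteMeasure (volume.restrict Ω)]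
    (hq : 2 ≤ q) (f : W1 Ω q) : H1 Ω where
  toFun := f.toFun
  grad := f.grad
  memLp_toFun := f.memLp_toFun.mono_exponent hq
  memLp_grad := f.memLp_grad.mono_exponent hq
  weak := f.weak

theorem HSol.memLp_vec {n : ℕ} {Ω : Set (Eu n)} (v : HSol Ω) :
    MemLp v.vec 2 (volume.restrict Ω) :=
  memLp_piLp_iff.2 fun i => (v.comp i).memLp_toFun

theorem tendsto_eLpNorm_sub_sub {α E : Type*} [MeasurableSpace α] [NormedAddCommGroup E]
    {ν : Measure α} {a b : ℕ → α → E} {f g : α → E}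
    (ha : ∀ k, AEStronglyMeasurable (fun x => a k x - f x) ν)
    (hb : ∀ k, AEStronglyMeasurable (fun x => b k x - g x) ν)
    (hf : Tendsto (fun k => eLpNorm (fun x => a k x - f x) 2 ν) atTop (𝓝 0))
    (hg : Tendsto (fun k => eLpNorm (fun x => b k x - g x) 2 ν) atTop (𝓝 0)) :
    Tendsto (fun k => eLpNorm (fun x => (a k x - b k x) - (f x - g x)) 2 ν) atTop (𝓝 0) := by
  have h0 := hf.add hg
  rw [add_zero] at h0
  refine tendsto_of_tendsto_of_tendsto_of_le_of_le tendsto_const_nhds h0 (fun _ => zero_le)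
    fun k => ?_
  have : (fun x => (a k x - b k x) - (f x - g x))
      = (fun x => a k x - f x) - fun x => b k x - g x := by
    funext x; simp only [Pi.sub_apply]; abel
  simp only [this]
  exact eLpNorm_sub_le (ha k) (hb k) (by norm_num)

/-- The increment `φ - φ₀` is thereby an admissible test function in the potential equation, with
boundary values `φΓ - φΓ₀`. -/
theorem IsTrace.sub {n : ℕ} {Ω : Set (Eu n)} {f g : H1 Ω} {fΓ gΓ : Eu n → ℝ}
    (hf : IsTrace f fΓ) (hg : IsTrace g gΓ) :
    IsTrace (f.sub g) (fun x => fΓ x - gΓ x) := by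
  obtain ⟨hfL, ψ, hψ, ⟨hψ0, hψ1⟩, hψΓ⟩ := hf
  obtain ⟨hgL, χ, hχ, ⟨hχ0, hχ1⟩, hχΓ⟩ := hg
  have hm : ∀ {ν : Measure (Eu n)} (k : ℕ), AEStronglyMeasurable (ψ k) ν := fun k =>
    (hψ k).continuous.aestronglyMeasurable
  have hm' : ∀ {ν : Measure (Eu n)} (k : ℕ), AEStronglyMeasurable (χ k) ν := fun k =>
    (hχ k).continuous.aestronglyMeasurable
  refine ⟨hfL.sub hgL, fun k x => ψ k x - χ k x, fun k => (hψ k).sub (hχ k), ⟨?_, ?_⟩, ?_⟩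
  · exact tendsto_eLpNorm_sub_sub (fun k => (hm k).sub f.memLp_toFun.1)
      (fun k => (hm' k).sub g.memLp_toFun.1) hψ0 hχ0
  · have := tendsto_eLpNorm_sub_sub
      (fun k => (continuous_gradient_of_contDiff (hψ k)).aestronglyMeasurable.sub f.memLp_grad.1)
      (fun k => (continuous_gradient_of_contDiff (hχ k)).aestronglyMeasurable.sub g.memLp_grad.1)
      hψ1 hχ1
    refine this.congr fun k => ?_
    congr 1
    funext x
    rw [gradient_sub_of_contDiff (hψ k) (hχ k)]
    rfl
  · exact tendsto_eLpNorm_sub_sub (fun k => (hm k).sub hfL.1) (fun k => (hm' k).sub hgL.1) hψΓ hχΓ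

/-! ### Integrability -/

theorem MeasureTheory.MemLp.integrable_inner_two {α E : Type*} [MeasurableSpace α]
    [NormedAddCommGroup E] [InnerProductSpace ℝ E] {ν : Measure α} {f g : α → E} (hf : MemLp f 2 ν)
    (hg : MemLp g 2 ν) : Integrable (fun x => ⟪f x, g x⟫_ℝ) ν := by
  refine (L2.integrable_inner (𝕜 := ℝ) (hf.toLp f) (hg.toLp g)).congr ?_
  filter_upwards [hf.coeFn_toLp, hg.coeFn_toLp] with x hx hx'
  rw [hx, hx']

theorem MeasureTheory.MemLp.exists_bound_of_top {α : Type*} [MeasurableSpace α]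
    {ν : Measure α} {f : α → ℝ}
    (hf : MemLp f ⊤ ν) : ∃ R : ℝ, ∀ᵐ x ∂ν, |f x| ≤ R := by
  refine ⟨(eLpNormEssSup f ν).toReal, ?_⟩
  have h : eLpNormEssSup f ν < ⊤ := by simpa [eLpNorm_exponent_top] using hf.2
  filter_upwards [ae_le_eLpNormEssSup (f := f) (μ := ν)] with x hx
  have := ENNReal.toReal_mono h.ne hx
  rwa [toReal_enorm, Real.norm_eq_abs] at this

theorem MeasureTheory.MemLp.continuous_comp_top {α : Type*} [MeasurableSpace α]
    {ν : Measure α} {f : α → ℝ}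
    {F : ℝ → ℝ} (hF : Continuous F) (hf : MemLp f ⊤ ν) : MemLp (fun x => F (f x)) ⊤ ν := by
  obtain ⟨R, hR⟩ := MemLp.exists_bound_of_top hf
  obtain ⟨C, hC⟩ := (isCompact_Icc (a := -R) (b := R)).exists_bound_of_continuousOn hF.continuousOn
  refine memLp_top_of_bound (hF.comp_aestronglyMeasurable hf.1) C ?_
  filter_upwards [hR] with x hx
  exact hC _ (abs_le.1 hx)

/-! ### The three parts of the energy balance -/

section Balance

variable {α E : Type*} [MeasurableSpace α] [NormedAddCommGroup E] [InnerProductSpace ℝ E]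
  {ν : Measure α}

/-- The convective coupling terms of the momentum and the phase field equation do not cancel, since
the latter transports with the old velocity. The mismatch `τ p ⟨m, v - v₀⟩` is controlled by the
numerical dissipation `a₀ |v - v₀|² / 2` together with the stabilising term `τ² p² |m|² / c`. -/
theorem kinetic_le_add_inner {c τ a a₀ p : ℝ} (hc : 0 < c) (ha : c ≤ a₀) (v v₀ m : E) :
    1 / 2 * (a * ‖v‖ ^ 2) ≤ 1 / 2 * (a₀ * ‖v₀‖ ^ 2) + ⟪((a + a₀) / 2) • v - a₀ • v₀, v⟫_ℝ
      + τ * ⟪p • m, v⟫_ℝ - τ * ⟪p • v₀, m⟫_ℝ + τ * (τ / c * ⟪|p| ^ 2 • m, m⟫_ℝ) := by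
  have h1 : 0 ≤ 1 / 2 * (a₀ - c) * ‖v - v₀‖ ^ 2 := by
    have := sub_nonneg.2 ha; positivity
  have h2 : 0 ≤ c / 2 * ‖(v - v₀) + (τ * p / c) • m‖ ^ 2 := by positivity
  have h3 : 0 ≤ τ ^ 2 * p ^ 2 / (2 * c) * ‖m‖ ^ 2 := by positivity
  rw [norm_sub_sq_real] at h1
  rw [norm_add_sq_real, norm_sub_sq_real, norm_smul, mul_pow, Real.norm_eq_abs, sq_abs,
    inner_smul_right, inner_sub_left] at h2
  simp only [inner_sub_left, real_inner_smul_left, sq_abs, real_inner_self_eq_norm_sq]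
  rw [real_inner_comm v v₀, real_inner_comm v m]
  have e1 : c / 2 * (‖v‖ ^ 2 - 2 * ⟪v, v₀⟫_ℝ + ‖v₀‖ ^ 2
        + 2 * (τ * p / c * (⟪v, m⟫_ℝ - ⟪v₀, m⟫_ℝ)) + (τ * p / c) ^ 2 * ‖m‖ ^ 2)
      = c / 2 * (‖v‖ ^ 2 - 2 * ⟪v, v₀⟫_ℝ + ‖v₀‖ ^ 2) + τ * p * (⟪v, m⟫_ℝ - ⟪v₀, m⟫_ℝ)
        + τ ^ 2 * p ^ 2 / (2 * c) * ‖m‖ ^ 2 := by field_simp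
  have e2 : τ * (τ / c * (p ^ 2 * ‖m‖ ^ 2))
      = 2 * (τ ^ 2 * p ^ 2 / (2 * c) * ‖m‖ ^ 2) := by field_simp
  rw [e1] at h2
  rw [e2]
  linarith

theorem integral_kinetic_le {c τ : ℝ} (hc : 0 < c) {a a₀ p : α → ℝ} {v v₀ m : α → E}
    (hca : ∀ x, c ≤ a₀ x) (ha : MemLp a ⊤ ν) (ha₀ : MemLp a₀ ⊤ ν) (hp : MemLp p ⊤ ν)
    (hv : MemLp v 2 ν) (hv₀ : MemLp v₀ 2 ν) (hm : MemLp m 2 ν) :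
    1 / 2 * (∫ x, a x * ‖v x‖ ^ 2 ∂ν) ≤ 1 / 2 * (∫ x, a₀ x * ‖v₀ x‖ ^ 2 ∂ν)
      + (∫ x, ⟪((a x + a₀ x) / 2) • v x - a₀ x • v₀ x, v x⟫_ℝ ∂ν)
      + τ * (∫ x, ⟪p x • m x, v x⟫_ℝ ∂ν) - τ * (∫ x, ⟪p x • v₀ x, m x⟫_ℝ ∂ν)
      + τ * (τ / c * (∫ x, ⟪|p x| ^ 2 • m x, m x⟫_ℝ ∂ν)) := by
  have hsq : ∀ {b : α → ℝ} {w : α → E}, MemLp b ⊤ ν → MemLp w 2 ν →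
      Integrable (fun x => b x * ‖w x‖ ^ 2) ν := fun hb hw => by
    refine ((hw.smul (r := 2) hb).integrable_inner_two hw).congr (ae_of_all _ fun x => ?_)
    simp only [Pi.smul_apply', real_inner_smul_left, real_inner_self_eq_norm_sq]
  have hmean : MemLp (fun x => (a x + a₀ x) / 2) ⊤ ν := by
    simp only [div_eq_inv_mul]
    exact (ha.add ha₀).const_mul (2⁻¹ : ℝ)
  have hpp : MemLp (fun x => |p x| ^ 2) ⊤ ν :=
    hp.continuous_comp_top (F := fun s => |s| ^ 2) (by fun_prop)
  have i1 := (hsq ha hv).const_mul (1 / 2)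
  have i2 := (hsq ha₀ hv₀).const_mul (1 / 2)
  have i3 : Integrable (fun x => ⟪((a x + a₀ x) / 2) • v x - a₀ x • v₀ x, v x⟫_ℝ) ν :=
    ((hv.smul (r := 2) hmean).sub (hv₀.smul (r := 2) ha₀)).integrable_inner_two hv
  have i4 : Integrable (fun x => τ * ⟪p x • m x, v x⟫_ℝ) ν :=
    ((hm.smul (r := 2) hp).integrable_inner_two hv).const_mul τ
  have i5 : Integrable (fun x => τ * ⟪p x • v₀ x, m x⟫_ℝ) ν :=
    ((hv₀.smul (r := 2) hp).integrable_inner_two hm).const_mul τ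
  have i6 : Integrable (fun x => τ * (τ / c * ⟪|p x| ^ 2 • m x, m x⟫_ℝ)) ν :=
    (((hm.smul (r := 2) hpp).integrable_inner_two hm).const_mul (τ / c)).const_mul τ
  have key := integral_mono i1 ((((i2.add i3).add i4).sub i5).add i6)
    fun x => kinetic_le_add_inner (τ := τ) (a := a x) (p := p x) hc (hca x) (v x) (v₀ x) (m x)
  rw [integral_add' (((i2.add i3).add i4).sub i5) i6, integral_sub' ((i2.add i3).add i4) i5,
    integral_add' (i2.add i3) i4, integral_add' i2 i3] at key
  simpa only [integral_const_mul] using key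

/-- Convex splitting: the gradient term and `Wc` are treated implicitly, `Wn` explicitly. -/
theorem integral_ginzburgLandau_le [IsFiniteMeasure ν] {σ ε : ℝ} (hσ : 0 ≤ σ) (hε : 0 < ε)
    {W Wc Wn : ℝ → ℝ} (hsplit : ∀ s, W s = Wc s + Wn s) (hW : Continuous W)
    (hconv : ConvexOn ℝ Set.univ Wc) (hconc : ConcaveOn ℝ Set.univ Wn)
    (hcd : Differentiable ℝ Wc) (hcd' : Differentiable ℝ (deriv Wc))
    (hnd : Differentiable ℝ Wn) (hnd' : Differentiable ℝ (deriv Wn))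
    {p p₀ : α → ℝ} {g g₀ : α → E} (hp : MemLp p ⊤ ν) (hp₀ : MemLp p₀ ⊤ ν)
    (hg : MemLp g 2 ν) (hg₀ : MemLp g₀ 2 ν) :
    σ * (∫ x, (ε / 2 * ‖g x‖ ^ 2 + 1 / ε * W (p x)) ∂ν)
      ≤ σ * (∫ x, (ε / 2 * ‖g₀ x‖ ^ 2 + 1 / ε * W (p₀ x)) ∂ν)
        + σ * ε * (∫ x, ⟪g x, g x - g₀ x⟫_ℝ ∂ν)
        + σ / ε * (∫ x, (deriv Wc (p x) + deriv Wn (p₀ x)) * (p x - p₀ x) ∂ν) := by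
  have henergy : ∀ {h : α → E} {r : α → ℝ}, MemLp h 2 ν → MemLp r ⊤ ν →
      Integrable (fun x => σ * (ε / 2 * ‖h x‖ ^ 2 + 1 / ε * W (r x))) ν := fun hh hr =>
    (((hh.integrable_norm_pow (by norm_num)).const_mul _).add
      (((hr.continuous_comp_top hW).integrable le_top).const_mul _)).const_mul σ
  have i1 := henergy hg hp
  have i2 := henergy hg₀ hp₀
  have i3 : Integrable (fun x => σ * ε * ⟪g x, g x - g₀ x⟫_ℝ) ν :=
    (hg.integrable_inner_two (hg.sub hg₀)).const_mul _
  have hder : MemLp (fun x => deriv Wc (p x) + deriv Wn (p₀ x)) ⊤ ν :=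
    (hp.continuous_comp_top hcd'.continuous).add (hp₀.continuous_comp_top hnd'.continuous)
  have i4 : Integrable (fun x => σ / ε * ((deriv Wc (p x) + deriv Wn (p₀ x)) * (p x - p₀ x))) ν :=
    ((MemLp.integrable_mul (p := ⊤) (q := 1) hder ((hp.sub hp₀).mono_exponent le_top))).const_mul _
  have key := integral_mono i1 ((i2.add i3).add i4) fun x => ?_
  · rw [integral_add' (i2.add i3) i4, integral_add' i2 i3] at key
    simpa only [integral_const_mul] using key
  · have h1 : 0 ≤ σ * ε / 2 * ‖g x - g₀ x‖ ^ 2 := by positivity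
    have hc := hconv.deriv_mul_sub_le hcd (p x) (p₀ x)
    have hn := hconc.sub_le_deriv_mul_sub hnd (p₀ x) (p x)
    have h2 : 0 ≤ σ / ε * ((deriv Wc (p x) + deriv Wn (p₀ x)) * (p x - p₀ x)
        - (W (p x) - W (p₀ x))) := by
      refine mul_nonneg (by positivity) ?_
      rw [hsplit, hsplit]
      linarith
    rw [norm_sub_sq_real] at h1
    simp only [Pi.add_apply, inner_sub_right, real_inner_self_eq_norm_sq]
    have e : ∀ s : ℝ, σ * (1 / ε * s) = σ / ε * s := fun s => by ring
    rw [mul_add, mul_add, e, e]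
    linarith

end Balance

/-! ### The contact line energy -/

/-- A function that is constant on both sides of a compact interval is bounded together with its
derivative. -/
theorem exists_bound_of_const_outside {ϑ : ℝ → ℝ} (hϑ : ContDiff ℝ 2 ϑ) {cl cr : ℝ}
    (hl : ∀ s, s ≤ -1 → ϑ s = cl) (hr : ∀ s, 1 ≤ s → ϑ s = cr) :
    ∃ C, ∀ s, |ϑ s| ≤ C ∧ |deriv ϑ s| ≤ C := by
  have hcd : Continuous (deriv ϑ) := hϑ.continuous_deriv (by norm_num)
  obtain ⟨C₀, h₀⟩ :=
    (isCompact_Icc (a := (-1 : ℝ)) (b := 1)).exists_bound_of_continuousOn hϑ.continuous.continuousOn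
  obtain ⟨C₁, h₁⟩ :=
    (isCompact_Icc (a := (-1 : ℝ)) (b := 1)).exists_bound_of_continuousOn hcd.continuousOn
  have hl' : ∀ s, s < -1 → deriv ϑ s = 0 := fun s hs => by
    have : ϑ =ᶠ[𝓝 s] fun _ => cl :=
      eventually_of_mem (Iio_mem_nhds hs) fun t ht => hl t (le_of_lt ht)
    rw [this.deriv_eq, deriv_const]
  have hr' : ∀ s, 1 < s → deriv ϑ s = 0 := fun s hs => by
    have : ϑ =ᶠ[𝓝 s] fun _ => cr :=
      eventually_of_mem (Ioi_mem_nhds hs) fun t ht => hr t (le_of_lt ht)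
    rw [this.deriv_eq, deriv_const]
  refine ⟨max C₀ C₁, fun s => ?_⟩
  rcases lt_or_ge s (-1) with h | h
  · rw [hl s h.le, hl' s h, ← hl (-1) le_rfl, abs_zero]
    have := h₀ (-1) (by simp)
    rw [Real.norm_eq_abs] at this
    exact ⟨le_max_of_le_left this, le_max_of_le_left ((abs_nonneg _).trans this)⟩
  rcases lt_or_ge 1 s with h' | h'
  · rw [hr s h'.le, hr' s h', ← hr 1 le_rfl, abs_zero]
    have := h₀ 1 (by simp)
    rw [Real.norm_eq_abs] at this
    exact ⟨le_max_of_le_left this, le_max_of_le_left ((abs_nonneg _).trans this)⟩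
  · exact ⟨le_max_of_le_left (h₀ s ⟨h, h'⟩), le_max_of_le_right (h₁ s ⟨h, h'⟩)⟩

theorem ModelData.contDiff_γ {n : ℕ} {P : ModelData n} (hP : P.Admissible) (c : ℝ) :
    ContDiff ℝ 2 (P.γ c) :=
  contDiff_const.add (contDiff_const.mul hP.ϑ_smooth)

theorem ModelData.deriv_γ {n : ℕ} {P : ModelData n} (hP : P.Admissible) (c s : ℝ) :
    deriv (P.γ c) s = P.σlg * c * deriv P.ϑ s := by
  have h : HasDerivAt P.ϑ (deriv P.ϑ s) s :=
    (hP.ϑ_smooth.differentiable (by norm_num) s).hasDerivAt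
  exact ((h.const_mul (P.σlg * c)).const_add ((P.σsl + P.σsg) / 2)).deriv

theorem lineEnergy_le {n : ℕ} {Ω : Set (Eu n)} [IsFiniteMeasure (surf Ω)] {P : ModelData n}
    (hP : P.Admissible) {c s s₀ : Eu n → ℝ} (hc : MemLp c 2 (surf Ω)) (hs : MemLp s 2 (surf Ω))
    (hs₀ : MemLp s₀ 2 (surf Ω))
    (hS : ∀ᵐ x ∂(surf Ω), ∀ t, |deriv (deriv (P.γ (c x))) t| ≤ P.Sγ) :
    lineEnergy Ω P c s ≤ lineEnergy Ω P c s₀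
      + ∫ x, (P.Sγ / 2 * (s x - s₀ x) + deriv (P.γ (c x)) (s₀ x)) * (s x - s₀ x) ∂(surf Ω) := by
  obtain ⟨C, hC⟩ := exists_bound_of_const_outside hP.ϑ_smooth hP.ϑ_left hP.ϑ_right
  have hcd : Continuous (deriv P.ϑ) := hP.ϑ_smooth.continuous_deriv (by norm_num)
  have hσc : MemLp (fun x => P.σlg * c x) 2 (surf Ω) := hc.const_mul _
  have hγ : ∀ {t : Eu n → ℝ}, MemLp t 2 (surf Ω) →
      Integrable (fun x => P.γ (c x) (t x)) (surf Ω) := fun {t} ht => by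
    have hb : MemLp (fun x => P.ϑ (t x)) 2 (surf Ω) :=
      (memLp_top_of_bound (hP.ϑ_smooth.continuous.comp_aestronglyMeasurable ht.1) C
        (ae_of_all _ fun x => (hC (t x)).1)).mono_exponent le_top
    exact (integrable_const _).add (hσc.integrable_mul hb)
  have hd : MemLp (fun x => deriv (P.γ (c x)) (s₀ x)) 2 (surf Ω) := by
    have hb : MemLp (fun x => deriv P.ϑ (s₀ x)) ⊤ (surf Ω) :=
      memLp_top_of_bound (hcd.comp_aestronglyMeasurable hs₀.1) C
        (ae_of_all _ fun x => (hC (s₀ x)).2)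
    simp only [ModelData.deriv_γ hP]
    exact hb.mul' (r := 2) hσc
  have i3 : Integrable (fun x => (P.Sγ / 2 * (s x - s₀ x) + deriv (P.γ (c x)) (s₀ x))
      * (s x - s₀ x)) (surf Ω) :=
    (((hs.sub hs₀).const_mul _).add hd).integrable_mul (hs.sub hs₀)
  rw [lineEnergy, lineEnergy, ← integral_add (hγ hs₀) i3]
  refine integral_mono_ae (hγ hs) ((hγ hs₀).add i3) ?_
  filter_upwards [hS] with x hx
  have := sub_le_of_deriv_deriv_le (ModelData.contDiff_γ hP (c x))
    (fun t => (le_abs_self _).trans (hx t)) (s₀ x) (s x)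
  linarith

/-! ### The energy inequality -/

theorem triForm_self {n : ℕ} {Ω : Set (Eu n)} (a : Eu n → Eu n) (v : HSol Ω) :
    triForm a v v = 0 := sub_self _

/-- The energy inequality for one time step, obtained by testing the momentum equation with `v`,
the phase field equation with `μ` and the potential equation with `φ - φ₀`. -/
theorem energy_step {n : ℕ} {q : ℝ≥0∞} (hq : 2 ≤ q) {Ω : Set (Eu n)} (hΩ : IsLipschitzDomain Ω)
    {P : ModelData n} (hP : P.Admissible) {c : Eu n → ℝ} (hc : MemLp c 2 (surf Ω))
    (hS : ∀ᵐ x ∂(surf Ω), ∀ t, |deriv (deriv (P.γ (c x))) t| ≤ P.Sγ)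
    {v₀ v : HSol Ω} {φ₀ φ : H1 Ω} {φΓ₀ φΓ : Eu n → ℝ} {μ : W1 Ω q}
    (hφ₀ : MemLp φ₀.toFun ⊤ (volume.restrict Ω)) (hφ : MemLp φ.toFun ⊤ (volume.restrict Ω))
    (htr₀ : IsTrace φ₀ φΓ₀) (htr : IsTrace φ φΓ) (hmom : MomentumEq P v₀ v φ₀ φ μ)
    (hphase : PhaseEq P v₀ φ₀ φ μ) (hpot : PotentialEq P c φ₀ φ φΓ₀ φΓ μ) :
    bulkEnergy P v φ + lineEnergy Ω P c φΓ + P.τ * dissipation P v φ φΓ₀ φΓ μ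
      ≤ bulkEnergy P v₀ φ₀ + lineEnergy Ω P c φΓ₀ + P.τ * gravityPower P v φ := by
  have := hΩ.isFiniteMeasure_surf
  have := hΩ.isFiniteMeasure_restrict
  have hτ := hP.τ_pos
  have hρmin : 0 < P.ρmin := by
    obtain ⟨s, hs⟩ := hP.ρmin_isLeast.1
    exact hs ▸ hP.ρ_pos s
  have hσ : 0 ≤ P.σ := (mul_pos hP.cW_pos hP.σlg_pos).le
  have hρc := hP.ρ_smooth.continuous
  have kin := integral_kinetic_le (τ := P.τ) hρmin
    (fun x => hP.ρmin_isLeast.2 (Set.mem_range_self (φ₀.toFun x)))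
    (hφ.continuous_comp_top hρc) (hφ₀.continuous_comp_top hρc) hφ₀ v.memLp_vec v₀.memLp_vec
    (μ.toH1 hq).memLp_grad
  have gl := integral_ginzburgLandau_le hσ hP.ε_pos hP.W_split hP.W_smooth.continuous
    hP.Wconv_convex hP.Wconc_concave hP.Wconv_diff.1 hP.Wconv_diff.2 hP.Wconc_diff.1
    hP.Wconc_diff.2 hφ hφ₀ φ.memLp_grad φ₀.memLp_grad
  have line := lineEnergy_le hP hc htr.1 htr₀.1 hS
  have e1 := hmom v
  have e2 := hphase (μ.toH1 hq)
  have e3 := hpot (φ.sub φ₀) _ (htr.sub htr₀)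
  rw [triForm_self, add_zero] at e1
  have hgrav : (∫ x in Ω, ⟪P.ρ (φ.toFun x) • P.g, v.vec x⟫_ℝ) = gravityPower P v φ := by
    simp only [gravityPower, real_inner_smul_left]
  have hmu : (∫ x in Ω, (φ.toFun x - φ₀.toFun x) * μ.toFun x)
      = ∫ x in Ω, μ.toFun x * (φ.toFun x - φ₀.toFun x) := by simp only [mul_comm]
  have hgradmu : (∫ x in Ω, ⟪μ.grad x, μ.grad x⟫_ℝ) = ∫ x in Ω, ‖μ.grad x‖ ^ 2 := by
    simp only [real_inner_self_eq_norm_sq]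
  have hbdry : (∫ x, (φΓ x - φΓ₀ x) / P.τ * (φΓ x - φΓ₀ x) ∂(surf Ω))
      = P.τ * ∫ x, |(φΓ x - φΓ₀ x) / P.τ| ^ 2 ∂(surf Ω) := by
    rw [← integral_const_mul]
    refine integral_congr_ae (ae_of_all _ fun x => ?_)
    simp only [sq_abs]
    field_simp
  simp only [W1.sub, hbdry] at e3
  simp only [W1.toH1, hmu, hgradmu] at e2
  simp only [W1.toH1] at kin
  rw [hgrav] at e1
  -- multiplying by `τ` clears the factors `1 / τ`
  have cancel : ∀ t : ℝ, P.τ * (1 / P.τ * t) = t := fun t => by field_simp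
  rw [← mul_right_inj' hτ.ne', mul_zero] at e1 e2
  rw [mul_sub, mul_add, mul_add, cancel] at e1
  rw [mul_add, mul_add, mul_sub, cancel] at e2
  simp only [bulkEnergy, dissipation, mul_add]
  linarith

theorem memLp_angleCoeff {n : ℕ} {Ω : Set (Eu n)} (hΩ : IsLipschitzDomain Ω) {T : ℝ}
    (P : ModelData n) (f : BoundaryL2 Ω T) (m : ℕ) : MemLp (angleCoeff P f m) 2 (surf Ω) := by
  have := hΩ.isFiniteMeasure_surf
  have hcos : MemLp (fun _ : Eu n => Real.cos P.θeq) 2 (surf Ω) := memLp_const _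
  unfold angleCoeff
  generalize controlMean P.τ f m = g
  exact hcos.add (Lp.memLp g)

/-- Summation of one-step inequalities in which the potential `L m` may change with the step: the
sum telescopes up to the jumps of `L` at fixed states. -/
theorem sum_energy_steps {M : ℕ} {τ : ℝ} {F D G : ℕ → ℝ} {L : ℕ → ℕ → ℝ}
    (step : ∀ m, 1 ≤ m → m ≤ M → F m + L m m + τ * D m ≤ F (m - 1) + L m (m - 1) + τ * G m)
    (m : ℕ) (h1 : 1 ≤ m) (hM : m ≤ M) :
    F m + L m m + τ * ∑ k ∈ Finset.Icc 1 m, D k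
      ≤ F 0 + L 1 0 + τ * ∑ k ∈ Finset.Icc 1 m, G k
        + ∑ k ∈ Finset.Ico 1 m, (L (k + 1) k - L k k) := by
  induction m, h1 using Nat.le_induction with
  | base => simpa using step 1 le_rfl hM
  | succ m h1 ih =>
    have h := step (m + 1) (by omega) hM
    rw [Nat.add_sub_cancel] at h
    rw [Finset.sum_Icc_succ_top (by omega), Finset.sum_Icc_succ_top (by omega),
      Finset.sum_Ico_succ_top h1, mul_add, mul_add]
    linarith [ih (by omega)]

theorem mainTheorem8 {n : ℕ} {q : ℝ≥0∞} (hnq : (n = 2 ∧ 2 < q) ∨ (n = 3 ∧ 3 ≤ q))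
    {Ω : Set (Eu n)} (hΩ : IsLipschitzDomain Ω)
    (P : ModelData n) (hP : P.Admissible) (M : ℕ)
    {U : Type*} [NormedAddCommGroup U] [NormedSpace ℝ U]
    (B : U →L[ℝ] BoundaryL2 Ω (M * P.τ)) (hB : Function.Injective B)
    (u : U) (hu : u ∈ admissibleControls P B)
    (hS : ∀ m, 1 ≤ m → m ≤ M → ∀ᵐ x ∂(surf Ω), ∀ s : ℝ,
      |deriv (deriv (P.γ (angleCoeff P (B u) m x))) s| ≤ P.Sγ)
    (v : ℕ → HSol Ω) (φ : ℕ → H1 Ω) (φΓ : ℕ → Eu n → ℝ) (μ : ℕ → W1 Ω q)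
    (hsol : IsSolution P M (angleCoeff P (B u)) v φ φΓ μ) :
    -- the one-step inequality
    (∀ m, 1 ≤ m → m ≤ M →
      bulkEnergy P (v m) (φ m) + lineEnergy Ω P (angleCoeff P (B u) m) (φΓ m)
          + P.τ * dissipation P (v m) (φ m) (φΓ (m - 1)) (φΓ m) (μ m)
        ≤ bulkEnergy P (v (m - 1)) (φ (m - 1))
          + lineEnergy Ω P (angleCoeff P (B u) m) (φΓ (m - 1))
          + P.τ * gravityPower P (v m) (φ m)) ∧
    -- the cumulative inequality, for a contact line energy that may change from step to step
    (∀ m, 1 ≤ m → m ≤ M →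
      bulkEnergy P (v m) (φ m) + lineEnergy Ω P (angleCoeff P (B u) m) (φΓ m)
          + P.τ * ∑ k ∈ Finset.Icc 1 m,
              dissipation P (v k) (φ k) (φΓ (k - 1)) (φΓ k) (μ k)
        ≤ bulkEnergy P (v 0) (φ 0) + lineEnergy Ω P (angleCoeff P (B u) 1) (φΓ 0)
          + P.τ * ∑ k ∈ Finset.Icc 1 m, gravityPower P (v k) (φ k)
          + ∑ k ∈ Finset.Ico 1 m,
              (lineEnergy Ω P (angleCoeff P (B u) (k + 1)) (φΓ k)
                - lineEnergy Ω P (angleCoeff P (B u) k) (φΓ k))) ∧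
    -- the cumulative inequality, for a contact line energy that is the same in all steps
    (∀ m, 1 ≤ m → m ≤ M →
      (∀ k, 1 ≤ k → k ≤ m → controlMean P.τ (B u) k = controlMean P.τ (B u) 1) →
      bulkEnergy P (v m) (φ m) + lineEnergy Ω P (angleCoeff P (B u) 1) (φΓ m)
          + P.τ * ∑ k ∈ Finset.Icc 1 m,
              dissipation P (v k) (φ k) (φΓ (k - 1)) (φΓ k) (μ k)
        ≤ bulkEnergy P (v 0) (φ 0) + lineEnergy Ω P (angleCoeff P (B u) 1) (φΓ 0)
          + P.τ * ∑ k ∈ Finset.Icc 1 m, gravityPower P (v k) (φ k)) := by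
  have hq : 2 ≤ q := by
    rcases hnq with ⟨-, h⟩ | ⟨-, h⟩
    · exact h.le
    · exact le_trans (by norm_num) h
  have step : ∀ m, 1 ≤ m → m ≤ M →
      bulkEnergy P (v m) (φ m) + lineEnergy Ω P (angleCoeff P (B u) m) (φΓ m)
          + P.τ * dissipation P (v m) (φ m) (φΓ (m - 1)) (φΓ m) (μ m)
        ≤ bulkEnergy P (v (m - 1)) (φ (m - 1))
          + lineEnergy Ω P (angleCoeff P (B u) m) (φΓ (m - 1))
          + P.τ * gravityPower P (v m) (φ m) := fun m h1 hM =>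
    energy_step hq hΩ hP (memLp_angleCoeff hΩ P (B u) m) (hS m h1 hM)
      (hsol.bounded (m - 1) (by omega)) (hsol.bounded m hM) (hsol.trace (m - 1) (by omega))
      (hsol.trace m hM) (hsol.momentum m h1 hM) (hsol.phase m h1 hM) (hsol.potential m h1 hM)
  have cumulative := fun m h1 hM => sum_energy_steps
    (F := fun m => bulkEnergy P (v m) (φ m))
    (L := fun k m => lineEnergy Ω P (angleCoeff P (B u) k) (φΓ m)) step m h1 hM
  refine ⟨step, cumulative, fun m h1 hM hconst => ?_⟩
  have hangle : ∀ k, 1 ≤ k → k ≤ m → angleCoeff P (B u) k = angleCoeff P (B u) 1 :=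
    fun k hk hkm => by funext x; rw [angleCoeff, angleCoeff, hconst k hk hkm]
  have hsum : ∑ k ∈ Finset.Ico 1 m, (lineEnergy Ω P (angleCoeff P (B u) (k + 1)) (φΓ k)
      - lineEnergy Ω P (angleCoeff P (B u) k) (φΓ k)) = 0 := by
    refine Finset.sum_eq_zero fun k hk => ?_
    rw [Finset.mem_Ico] at hk
    rw [hangle (k + 1) (by omega) (by omega), hangle k hk.1 hk.2.le, sub_self]
  have h := cumulative m h1 hM
  simp only [hsum, add_zero, hangle m h1 le_rfl] at h
  exact h
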